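/- Let $\mathbb T$ be the unit circle and let $n\ge 0$. For $P=\mathbb N^n$ (with $0\in\mathbb N$) or $P=\mathbb Z^n$, a 2-cocycle on $P$ is a function $\sigma\colon P\times P\to\mathbb T$ with $\sigma(p,q)\sigma(p+q,r)=\sigma(p,q+r)\sigma(q,r)$ for all $p,q,r\in P$, and a coboundary is a function of the form $(p,q)\mapsto\mu(p+q)\mu(p)^{-1}\mu(q)^{-1}$ for some function $\mu\colon P\to\mathbb T$. Let $(\delta_q)_{q\in P}$ be the canonical orthonormal basis of $\ell^2(P)$, and let $L^\sigma_p$ be the isometry of $\ell^2(P)$ with $L^\sigma_p\delta_q=\sigma(p,q)\delta_{p+q}$ for all $q\in P$. Write $\mathcal T_r(\mathbb N^n,\sigma)$ for the $C^*$-subalgebra of $\mathcal B(\ell^2(\mathbb N^n))$ generated by $\{L^\sigma_p : p\in\mathbb N^n\}$. For a 2-cocycle $\tilde\sigma$ on $\mathbb Z^n$ write $\lambda^{\tilde\sigma}_p$ for the unitary $L^{\tilde\sigma}_p$ on $\ell^2(\mathbb Z^n)$, and $C^*_r(\mathbb Z^n,\tilde\sigma)$ for the $C^*$-subalgebra of $\mathcal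 B(\ell^2(\mathbb Z^n))$ generated by $\{\lambda^{\tilde\sigma}_p : p\in\mathbb Z^n\}$. Let $\sigma$ be a 2-cocycle on $\mathbb N^n$. 1. There is a 2-cocycle $\tilde\sigma$ on $\mathbb Z^n$ with $\tilde\sigma(p,q)=\sigma(p,q)$ for all $p,q\in\mathbb N^n$ (an extension of $\sigma$). 2. If $\tilde\sigma_1$ and $\tilde\sigma_2$ are two such extensions of $\sigma$, then $\tilde\sigma_1\tilde\sigma_2^{-1}$ is a coboundary on $\mathbb Z^n$. 3. For every extension $\tilde\sigma$ of $\sigma$ to a 2-cocycle on $\mathbb Z^n$ there is a unique $*$-homomorphism $\phi\colon\mathcal T_r(\mathbb N^n,\sigma)\to C^*_r(\mathbb Z^n,\tilde\sigma)$ with $\phi(L^\sigma_p)=\lambda^{\tilde\sigma}_p$ for all $p\in\mathbb N^n$. It is surjective, and its kernel is the closed two-sided ideal $\mathcal I$ of $\mathcal T_r(\mathbb N^n,\sigma)$ generated by the projections $1-L^\sigma_{e_j}(L^\sigma_{e_j})^*$, $j=1,\dots,n$, where $e_1,\dots,e_n$ are the standard generators of $\mathbb N^n$. That is, the sequence $$0\to\mathcal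 I\to\mathcal T_r(\mathbb N^n,\sigma)\xrightarrow{\ \phi\ }C^*_r(\mathbb Z^n,\tilde\sigma)\to0$$ is exact. -/

import Mathlib

noncomputable section

namespace TwistedSemigroup

/-- A circle-valued `2`-cocycle on the (additively written) monoid `P`. -/
def IsTwoCocycle {P : Type*} [AddMonoid P] (σ : P → P → Circle) : Prop :=
  ∀ p q r : P, σ p q * σ (p + q) r = σ p (q + r) * σ q r

/-- A circle-valued coboundary: `(p, q) ↦ μ (p + q) * (μ p)⁻¹ * (μ q)⁻¹` for some `μ : P → 𝕋`. -/
def IsCoboundary {P : Type*} [AddMonoid P] (σ : P → P → Circle) : Prop :=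
  ∃ μ : P → Circle, ∀ p q : P, σ p q = μ (p + q) * (μ p)⁻¹ * (μ q)⁻¹

/-- The inclusion of `ℕⁿ` in `ℤⁿ`. -/
def natToInt {n : ℕ} (p : Fin n → ℕ) : Fin n → ℤ := fun i => (p i : ℤ)

/-- `τ`, defined on `ℤⁿ`, extends `σ`, defined on `ℕⁿ`. -/
def Extends {n : ℕ} (τ : (Fin n → ℤ) → (Fin n → ℤ) → Circle)
    (σ : (Fin n → ℕ) → (Fin n → ℕ) → Circle) : Prop :=
  ∀ p q : Fin n → ℕ, τ (natToInt p) (natToInt q) = σ p q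

/-- The Hilbert space `ℓ²(P)`. -/
abbrev L2 (P : Type*) : Type _ := lp (fun _ : P => ℂ) 2

open Classical in
/-- The canonical orthonormal basis vector `δ_q` of `ℓ²(P)`. -/
def delta {P : Type*} (q : P) : L2 P := lp.single 2 q (1 : ℂ)

theorem orthonormal_delta (P : Type*) : Orthonormal ℂ (delta : P → L2 P) := by
  classical
  rw [orthonormal_iff_ite]
  intro i j
  unfold delta
  rw [lp.inner_single_left, lp.single_apply, Pi.single_apply]
  split_ifs <;> simp

theorem orthonormal_twisted_translate {P : Type*} [AddMonoid P] [IsLeftCancelAdd P]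
    (σ : P → P → Circle) (p : P) :
    Orthonormal ℂ (fun q : P => ((σ p q : Circle) : ℂ) • (delta (p + q) : L2 P)) := by
  have h := (orthonormal_delta P).comp (fun q : P => p + q) (add_right_injective p)
  refine ⟨fun q => ?_, fun q r hqr => ?_⟩
  · have h1 : ‖((σ p q : Circle) : ℂ)‖ = 1 := Circle.norm_coe _
    change ‖((σ p q : Circle) : ℂ) • (delta (p + q) : L2 P)‖ = 1
    rw [norm_smul, (orthonormal_delta P).1, h1, one_mul]
  · have h0 : inner ℂ (delta (p + q) : L2 P) (delta (p + r)) = 0 := h.2 hqr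
    change inner ℂ (((σ p q : Circle) : ℂ) • (delta (p + q) : L2 P))
      (((σ p r : Circle) : ℂ) • (delta (p + r) : L2 P)) = 0
    rw [inner_smul_left, inner_smul_right, h0, mul_zero, mul_zero]

/-- The operator `L^σ_p` on `ℓ²(P)`: the isometry with `L^σ_p δ_q = σ(p, q) δ_{p + q}`. -/
def leftRegular {P : Type*} [AddMonoid P] [IsLeftCancelAdd P] (σ : P → P → Circle) (p : P) :
    L2 P →L[ℂ] L2 P :=
  (orthonormal_twisted_translate σ p).orthogonalFamily.linearIsometry.toContinuousLinearMap

theorem leftRegular_delta {P : Type*} [AddMonoid P] [IsLeftCancelAdd P] (σ : P → P → Circle)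
    (p q : P) :
    leftRegular σ p (delta q) = ((σ p q : Circle) : ℂ) • (delta (p + q) : L2 P) := by
  classical
  have h := (orthonormal_twisted_translate σ p).orthogonalFamily.linearIsometry_apply_single
    (i := q) (1 : ℂ)
  have h1 : (delta q : L2 P) = lp.single 2 q (1 : ℂ) := by
    unfold delta
    congr
  rw [h1]
  refine Eq.trans h ?_
  simp

/-- The reduced `C*`-algebra of `P` twisted by `σ`: the `C*`-subalgebra of `B(ℓ²(P))` generated by
the operators `L^σ_p`. For a cocycle `σ`, the operator `L^σ_0` is a unimodular multiple of the
identity, so that it does not matter whether the unit is adjoined. For a group `P` this is the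
reduced twisted group `C*`-algebra. -/
def reducedAlgebra {P : Type*} [AddMonoid P] [IsLeftCancelAdd P] (σ : P → P → Circle) :
    StarSubalgebra ℂ (L2 P →L[ℂ] L2 P) :=
  (StarAlgebra.adjoin ℂ (Set.range (leftRegular σ))).topologicalClosure

/-- `L^σ_p` as an element of the reduced twisted `C*`-algebra. -/
def gen {P : Type*} [AddMonoid P] [IsLeftCancelAdd P] (σ : P → P → Circle) (p : P) :
    reducedAlgebra σ :=
  ⟨leftRegular σ p, StarSubalgebra.le_topologicalClosure _
    (StarAlgebra.subset_adjoin ℂ _ (Set.mem_range_self p))⟩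

/-- The closed two-sided ideal of `A` generated by `S`. -/
def closedIdeal {A : Type*} [Ring A] [TopologicalSpace A] (S : Set A) : TwoSidedIdeal A :=
  sInf {I : TwoSidedIdeal A | IsClosed (I : Set A) ∧ S ⊆ (I : Set A)}

/-- The closed two-sided ideal of `𝒯_r(ℕⁿ, σ)` generated by `1 - L_{e_j} L_{e_j}^*`,
`j = 1, …, n`. -/
def toeplitzIdeal {n : ℕ} (σ : (Fin n → ℕ) → (Fin n → ℕ) → Circle) :
    TwoSidedIdeal (reducedAlgebra σ) :=
  closedIdeal (Set.range fun j : Fin n =>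
    1 - gen σ (Pi.single j 1) * star (gen σ (Pi.single j 1)))

end TwistedSemigroup

end

/-! Cohomology. The commutator `σ p q / σ q p` of a cocycle is bimultiplicative, hence fixed by its
values on generators, and a symmetric cocycle is a coboundary because the abelian extension it
defines splits over the free monoid `ℕⁿ` or the free group `ℤⁿ`. Dividing `σ` by a bicharacter with
the same commutator thus leaves a coboundary. Bicharacters and coboundaries both extend to `ℤⁿ`, and
two extensions of `σ` have the same commutator on generators, so their quotient is symmetric.

Operators. Let a `*`-polynomial in the `L^σ_p` have components `x.1` on `ℓ²(ℕⁿ)` and `x.2` on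
`ℓ²(ℤⁿ)`. Far from the boundary of `ℕⁿ` they agree. Right translations on `ℤⁿ` commute with `x.2`
and push finitely supported vectors into that region, so `‖x.2‖ ≤ ‖x.1‖` (`norm_snd_le_norm_fst`),
which makes `x.1 ↦ x.2` a well-defined map on closures. Conversely, for large `m` the cut-down `x.1
L_m L_m^*` has norm at most `‖x.2‖` (`exists_norm_mul_projection_le`). Since `1 - L_m L_m^*` lies in
the ideal, this one estimate gives both surjectivity and the kernel. -/

noncomputable section

namespace TwistedSemigroup

/-! ### Cocycles on `ℕⁿ` and `ℤⁿ`: commutators, bicharacters, coboundaries. -/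

section Cohomology

theorem IsTwoCocycle.div {P : Type*} [AddMonoid P] {σ τ : P → P → Circle}
    (hσ : IsTwoCocycle σ) (hτ : IsTwoCocycle τ) : IsTwoCocycle (σ / τ) := by
  intro p q r
  simp only [Pi.div_apply]
  rw [div_mul_div_comm, div_mul_div_comm, hσ, hτ]

theorem IsTwoCocycle.mul {P : Type*} [AddMonoid P] {σ τ : P → P → Circle}
    (hσ : IsTwoCocycle σ) (hτ : IsTwoCocycle τ) : IsTwoCocycle (σ * τ) := by
  intro p q r
  simp only [Pi.mul_apply]
  rw [mul_mul_mul_comm, hσ, hτ, mul_mul_mul_comm]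

theorem IsCoboundary.isTwoCocycle {P : Type*} [AddMonoid P] {σ : P → P → Circle}
    (hσ : IsCoboundary σ) : IsTwoCocycle σ := by
  obtain ⟨μ, hμ⟩ := hσ
  intro p q r
  simp only [hμ, add_assoc]
  rw [mul_comm (μ (p + q))]
  apply Additive.ofMul.injective
  simp only [ofMul_mul, ofMul_inv]
  abel

theorem IsTwoCocycle.zero_left {P : Type*} [AddMonoid P] {σ : P → P → Circle}
    (hσ : IsTwoCocycle σ) (p : P) : σ 0 p = σ 0 0 := by
  have h := hσ 0 0 p
  simp only [add_zero, zero_add] at h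
  exact (mul_right_cancel h).symm

theorem IsTwoCocycle.zero_right {P : Type*} [AddMonoid P] {σ : P → P → Circle}
    (hσ : IsTwoCocycle σ) (p : P) : σ p 0 = σ 0 0 := by
  have h := hσ p 0 0
  simp only [add_zero] at h
  exact mul_left_cancel h

/-- The commutator `(p, q) ↦ σ(p, q) σ(q, p)⁻¹` of a cocycle. -/
def commutator {P : Type*} (σ : P → P → Circle) (p q : P) : Circle := σ p q / σ q p

theorem commutator_swap {P : Type*} (σ : P → P → Circle) (p q : P) :
    commutator σ q p = (commutator σ p q)⁻¹ := by
  simp [commutator]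

/-- Combine the cocycle identity at `(p, q, r)`, `(r, p, q)` and `(p, r, q)`; commutativity of `P`
matches the terms. -/
theorem IsTwoCocycle.commutator_add_left {P : Type*} [AddCommMonoid P] {σ : P → P → Circle}
    (hσ : IsTwoCocycle σ) (p q r : P) :
    commutator σ (p + q) r = commutator σ p r * commutator σ q r := by
  have h1 := hσ p q r
  have h2 := hσ r p q
  have h3 := hσ p r q
  rw [add_comm r q] at h3
  rw [add_comm r p] at h2
  rw [mul_comm, ← eq_div_iff_mul_eq'] at h1 h3
  rw [← div_eq_iff_eq_mul] at h2
  simp only [commutator]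
  rw [h1, ← h2, h3]
  apply Additive.ofMul.injective
  simp only [ofMul_mul, ofMul_div]
  abel

theorem IsTwoCocycle.commutator_add_right {P : Type*} [AddCommMonoid P] {σ : P → P → Circle}
    (hσ : IsTwoCocycle σ) (p q r : P) :
    commutator σ p (q + r) = commutator σ p q * commutator σ p r := by
  rw [commutator_swap σ (q + r) p, hσ.commutator_add_left, mul_inv, ← commutator_swap,
    ← commutator_swap]

/-- The central extension of `P` by the circle determined by `ω`. -/
@[ext]
structure CentralExtension {P : Type*} (ω : P → P → Circle) where
  /-- The central component. -/
  scalar : Circle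
  /-- The component in `P`. -/
  base : P

namespace CentralExtension

variable {P : Type*}

/-- A symmetric cocycle defines a commutative extension. -/
abbrev commMonoid [AddCommMonoid P] {ω : P → P → Circle} (hω : IsTwoCocycle ω)
    (hs : ∀ p q, ω p q = ω q p) : CommMonoid (CentralExtension ω) where
  mul x y := ⟨x.scalar * y.scalar * ω x.base y.base, x.base + y.base⟩
  one := ⟨(ω 0 0)⁻¹, 0⟩
  mul_assoc x y z := by
    refine CentralExtension.ext ?_ (add_assoc _ _ _)
    have := hω x.base y.base z.base
    change x.scalar * y.scalar * ω x.base y.base * z.scalar * ω (x.base + y.base) z.base =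
      x.scalar * (y.scalar * z.scalar * ω y.base z.base) * ω x.base (y.base + z.base)
    calc _ = x.scalar * y.scalar * z.scalar * (ω x.base y.base * ω (x.base + y.base) z.base) := by
          ac_rfl
      _ = _ := by rw [this]; ac_rfl
  one_mul x := by
    refine CentralExtension.ext ?_ (zero_add _)
    change (ω 0 0)⁻¹ * x.scalar * ω 0 x.base = x.scalar
    rw [hω.zero_left x.base, mul_right_comm, inv_mul_cancel, one_mul]
  mul_one x := by
    refine CentralExtension.ext ?_ (add_zero _)
    change x.scalar * (ω 0 0)⁻¹ * ω x.base 0 = x.scalar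
    rw [hω.zero_right x.base, mul_assoc, inv_mul_cancel, mul_one]
  mul_comm x y := by
    refine CentralExtension.ext ?_ (add_comm _ _)
    change x.scalar * y.scalar * ω x.base y.base = y.scalar * x.scalar * ω y.base x.base
    rw [hs, mul_comm x.scalar]

/-- A symmetric cocycle on a commutative group defines an extension that is a commutative group. -/
abbrev commGroup [AddCommGroup P] {ω : P → P → Circle} (hω : IsTwoCocycle ω)
    (hs : ∀ p q, ω p q = ω q p) : CommGroup (CentralExtension ω) where
  __ := commMonoid hω hs
  inv x := ⟨x.scalar⁻¹ * (ω (-x.base) x.base)⁻¹ * (ω 0 0)⁻¹, -x.base⟩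
  inv_mul_cancel x := by
    refine CentralExtension.ext ?_ (neg_add_cancel _)
    change x.scalar⁻¹ * (ω (-x.base) x.base)⁻¹ * (ω 0 0)⁻¹ * x.scalar * ω (-x.base) x.base =
      (ω 0 0)⁻¹
    apply Additive.ofMul.injective
    simp only [ofMul_mul, ofMul_inv]
    abel

end CentralExtension

/-- A multiplicative section of the central extension trivializes the cocycle. -/
theorem isCoboundary_of_section {P : Type*} [AddCommMonoid P] {ω : P → P → Circle}
    (f : P → CentralExtension ω) (hf : ∀ p, (f p).base = p)
    (hadd : ∀ p q, (f (p + q)).scalar = (f p).scalar * (f q).scalar * ω (f p).base (f q).base) :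
    IsCoboundary ω := by
  refine ⟨fun p => (f p).scalar, fun p q => ?_⟩
  simp only [hadd, hf]
  apply Additive.ofMul.injective
  simp only [ofMul_mul, ofMul_inv]
  abel

/-- The extension is a commutative monoid, so lifts of the free generators extend to a
multiplicative section `p ↦ ∏ xᵢ ^ pᵢ`. -/
theorem isCoboundary_of_symmetric_nat {n : ℕ} {ω : (Fin n → ℕ) → (Fin n → ℕ) → Circle}
    (hω : IsTwoCocycle ω) (hs : ∀ p q, ω p q = ω q p) : IsCoboundary ω := by
  let := CentralExtension.commMonoid hω hs
  let b : CentralExtension ω →* Multiplicative (Fin n → ℕ) :=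
    { toFun := fun x => Multiplicative.ofAdd x.base
      map_one' := rfl
      map_mul' := fun _ _ => rfl }
  let f : (Fin n → ℕ) → CentralExtension ω := fun p => ∏ i, ⟨1, Pi.single i 1⟩ ^ p i
  have hmul (p q) : f (p + q) = f p * f q := by
    simp only [f, Pi.add_apply, pow_add, Finset.prod_mul_distrib]
  refine isCoboundary_of_section f (fun p => ?_) (fun p q => ?_)
  · change (b (f p)).toAdd = p
    simp only [f, map_prod, map_pow, toAdd_prod, toAdd_pow]
    change ∑ i, p i • (Pi.single i 1 : Fin n → ℕ) = p
    conv_rhs => rw [pi_eq_sum_univ' p]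
  · rw [hmul]; rfl

/-- Same splitting as over `ℕⁿ`; integer powers of the lifts exist because the extension is now a
group. -/
theorem isCoboundary_of_symmetric_int {n : ℕ} {ω : (Fin n → ℤ) → (Fin n → ℤ) → Circle}
    (hω : IsTwoCocycle ω) (hs : ∀ p q, ω p q = ω q p) : IsCoboundary ω := by
  let := CentralExtension.commGroup hω hs
  let b : CentralExtension ω →* Multiplicative (Fin n → ℤ) :=
    { toFun := fun x => Multiplicative.ofAdd x.base
      map_one' := rfl
      map_mul' := fun _ _ => rfl }
  let f : (Fin n → ℤ) → CentralExtension ω := fun p => ∏ i, ⟨1, Pi.single i 1⟩ ^ p i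
  have hmul (p q) : f (p + q) = f p * f q := by
    simp only [f, Pi.add_apply, zpow_add, Finset.prod_mul_distrib]
  refine isCoboundary_of_section f (fun p => ?_) (fun p q => ?_)
  · change (b (f p)).toAdd = p
    simp only [f, map_prod, map_zpow, toAdd_prod, toAdd_zpow]
    change ∑ i, p i • (Pi.single i 1 : Fin n → ℤ) = p
    conv_rhs => rw [pi_eq_sum_univ' p]
  · rw [hmul]; rfl

theorem multiplicative_ext_nat {n : ℕ} {f g : (Fin n → ℕ) → Circle}
    (hf : ∀ p q, f (p + q) = f p * f q) (hg : ∀ p q, g (p + q) = g p * g q)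
    (h : ∀ i, f (Pi.single i 1) = g (Pi.single i 1)) (p : Fin n → ℕ) : f p = g p := by
  have : AddMonoidHom.mk' (fun p => Additive.ofMul (f p)) (fun p q => by simp [hf]) =
      AddMonoidHom.mk' (fun p => Additive.ofMul (g p)) (fun p q => by simp [hg]) := by
    ext i
    simp [h]
  exact congrArg Additive.toMul (DFunLike.congr_fun this p)

theorem multiplicative_ext_int {n : ℕ} {f g : (Fin n → ℤ) → Circle}
    (hf : ∀ p q, f (p + q) = f p * f q) (hg : ∀ p q, g (p + q) = g p * g q)
    (h : ∀ i, f (Pi.single i 1) = g (Pi.single i 1)) (p : Fin n → ℤ) : f p = g p := by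
  have : AddMonoidHom.mk' (fun p => Additive.ofMul (f p)) (fun p q => by simp [hf]) =
      AddMonoidHom.mk' (fun p => Additive.ofMul (g p)) (fun p q => by simp [hg]) := by
    ext i
    simp [h]
  exact congrArg Additive.toMul (DFunLike.congr_fun this p)

theorem natToInt_add {n : ℕ} (p q : Fin n → ℕ) :
    natToInt (p + q) = natToInt p + natToInt q := by
  ext i
  simp [natToInt]

theorem natToInt_single {n : ℕ} (i : Fin n) : natToInt (Pi.single i 1) = Pi.single i 1 := by
  ext j
  by_cases h : j = i
  · subst h
    simp [natToInt]
  · simp [natToInt, h]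

theorem natToInt_injective {n : ℕ} : Function.Injective (natToInt : (Fin n → ℕ) → Fin n → ℤ) :=
  fun p q h => funext fun i => by simpa [natToInt] using congrFun h i

/-- The bicharacter of `ℤⁿ` with prescribed values on pairs of generators. -/
def bicharacter {n : ℕ} (θ : Fin n → Fin n → Circle) (p q : Fin n → ℤ) : Circle :=
  ∏ i, ∏ j, θ i j ^ (p i * q j)

theorem bicharacter_add_left {n : ℕ} (θ : Fin n → Fin n → Circle) (p q r : Fin n → ℤ) :
    bicharacter θ (p + q) r = bicharacter θ p r * bicharacter θ q r := by
  simp only [bicharacter, Pi.add_apply, add_mul, zpow_add, Finset.prod_mul_distrib]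

theorem bicharacter_add_right {n : ℕ} (θ : Fin n → Fin n → Circle) (p q r : Fin n → ℤ) :
    bicharacter θ p (q + r) = bicharacter θ p q * bicharacter θ p r := by
  simp only [bicharacter, Pi.add_apply, mul_add, zpow_add, Finset.prod_mul_distrib]

theorem bicharacter_single {n : ℕ} (θ : Fin n → Fin n → Circle) (i j : Fin n) :
    bicharacter θ (Pi.single i 1) (Pi.single j 1) = θ i j := by
  unfold bicharacter
  rw [Finset.prod_eq_single i, Finset.prod_eq_single j]
  · simp
  · intro k _ hk
    simp [hk]
  · simp
  · intro k _ hk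
    simp [hk]
  · simp

theorem isTwoCocycle_bicharacter {n : ℕ} (θ : Fin n → Fin n → Circle) :
    IsTwoCocycle (bicharacter θ) := by
  intro p q r
  rw [bicharacter_add_left, bicharacter_add_right, mul_assoc]

/-- Every cocycle on `ℕⁿ` is the product of a bicharacter and a coboundary. -/
theorem IsTwoCocycle.exists_bicharacter {n : ℕ} {σ : (Fin n → ℕ) → (Fin n → ℕ) → Circle}
    (hσ : IsTwoCocycle σ) : ∃ (θ : Fin n → Fin n → Circle) (μ : (Fin n → ℕ) → Circle),
      ∀ p q, σ p q = bicharacter θ (natToInt p) (natToInt q) *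
        (μ (p + q) * (μ p)⁻¹ * (μ q)⁻¹) := by
  -- The bicharacter has commutator `θ i j / θ j i` on generators. Putting the whole commutator of
  -- `σ` above the diagonal matches it without square roots.
  let θ : Fin n → Fin n → Circle := fun i j =>
    if i < j then commutator σ (Pi.single i 1) (Pi.single j 1) else 1
  let β : (Fin n → ℕ) → (Fin n → ℕ) → Circle := fun p q =>
    bicharacter θ (natToInt p) (natToInt q)
  have hl (p q r) : β (p + q) r = β p r * β q r := by
    simp only [β, natToInt_add, bicharacter_add_left]
  have hr (p q r) : β p (q + r) = β p q * β p r := by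
    simp only [β, natToInt_add, bicharacter_add_right]
  have hβ : IsTwoCocycle β := fun p q r => by rw [hl, hr, mul_assoc]
  have hc (p q) : commutator σ p q = commutator β p q := by
    refine multiplicative_ext_nat (f := fun p => commutator σ p q)
      (g := fun p => commutator β p q) (fun _ _ => hσ.commutator_add_left _ _ _)
      (fun _ _ => hβ.commutator_add_left _ _ _) (fun i => ?_) p
    refine multiplicative_ext_nat (f := fun q => commutator σ _ q)
      (g := fun q => commutator β _ q) (fun _ _ => hσ.commutator_add_right _ _ _)
      (fun _ _ => hβ.commutator_add_right _ _ _) (fun j => ?_) q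
    rw [commutator.eq_def β]
    simp only [β, natToInt_single, bicharacter_single, θ]
    rcases lt_trichotomy i j with h | rfl | h
    · simp [h, h.not_gt]
    · simp [commutator]
    · simp [h, h.not_gt, commutator]
  -- Equal commutators mean exactly that `σ / β` is symmetric.
  obtain ⟨μ, hμ⟩ := isCoboundary_of_symmetric_nat (hσ.div hβ) (fun p q => by
    have h := hc p q
    simp only [commutator] at h
    simp only [Pi.div_apply]
    rw [div_eq_div_iff_mul_eq_mul] at h ⊢
    rw [h, mul_comm])
  refine ⟨θ, μ, fun p q => ?_⟩
  rw [← hμ]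
  simp [β]

theorem IsTwoCocycle.exists_extension {n : ℕ} {σ : (Fin n → ℕ) → (Fin n → ℕ) → Circle}
    (hσ : IsTwoCocycle σ) :
    ∃ τ : (Fin n → ℤ) → (Fin n → ℤ) → Circle, IsTwoCocycle τ ∧ Extends τ σ := by
  obtain ⟨θ, μ, h⟩ := hσ.exists_bicharacter
  -- Any extension of `μ` to `ℤⁿ` would do, since every coboundary is a cocycle.
  let ν : (Fin n → ℤ) → Circle := fun p => μ fun i => (p i).toNat
  have hν (p) : ν (natToInt p) = μ p := by simp [ν, natToInt]
  refine ⟨bicharacter θ * fun p q => ν (p + q) * (ν p)⁻¹ * (ν q)⁻¹,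
    (isTwoCocycle_bicharacter θ).mul (IsCoboundary.isTwoCocycle ⟨ν, fun _ _ => rfl⟩),
    fun p q => ?_⟩
  simp only [Pi.mul_apply, ← natToInt_add, hν, h]

/-- The quotient is `1` on `ℕⁿ`, which contains the generators of `ℤⁿ`. Its bimultiplicative
commutator is therefore trivial and it is symmetric. -/
theorem isCoboundary_div_of_extends {n : ℕ} {σ : (Fin n → ℕ) → (Fin n → ℕ) → Circle}
    {τ₁ τ₂ : (Fin n → ℤ) → (Fin n → ℤ) → Circle} (h₁ : IsTwoCocycle τ₁) (e₁ : Extends τ₁ σ)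
    (h₂ : IsTwoCocycle τ₂) (e₂ : Extends τ₂ σ) : IsCoboundary (τ₁ / τ₂) := by
  have hω := h₁.div h₂
  refine isCoboundary_of_symmetric_int hω fun p q => ?_
  have hc : commutator (τ₁ / τ₂) p q = 1 := by
    refine multiplicative_ext_int (f := fun p => commutator _ p q) (g := fun _ => 1)
      (fun _ _ => hω.commutator_add_left _ _ _) (by simp) (fun i => ?_) p
    refine multiplicative_ext_int (f := fun q => commutator _ _ q) (g := fun _ => 1)
      (fun _ _ => hω.commutator_add_right _ _ _) (by simp) (fun j => ?_) q
    have e (p q) : (τ₁ / τ₂) (natToInt p) (natToInt q) = 1 := by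
      simp only [Pi.div_apply, e₁ p q, e₂ p q, div_self']
    simp only [commutator, ← natToInt_single, e, div_self']
  exact div_eq_one.mp hc

end Cohomology

/-! ### Twisted translations on `ℓ²`. -/

section Operators

theorem dense_span_delta (P : Type*) :
    Dense (Submodule.span ℂ (Set.range (delta : P → L2 P)) : Set (L2 P)) := by
  classical
  intro f
  have h := lp.hasSum_single (p := 2) (by simp) f
  refine mem_closure_of_tendsto h (Filter.Eventually.of_forall fun s => ?_)
  refine Submodule.sum_mem _ fun i _ => ?_
  have : lp.single 2 i (f i) = f i • (delta i : L2 P) := by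
    have e : (delta i : L2 P) = lp.single 2 i (1 : ℂ) := by
      unfold delta
      congr
    rw [e, ← lp.single_smul]
    simp
  rw [this]
  exact Submodule.smul_mem _ _ (Submodule.subset_span ⟨i, rfl⟩)

theorem clm_ext_delta {P E : Type*} [NormedAddCommGroup E] [NormedSpace ℂ E]
    {A B : L2 P →L[ℂ] E} (h : ∀ q, A (delta q) = B (delta q)) : A = B :=
  ContinuousLinearMap.ext_on (dense_span_delta P) (by rintro _ ⟨q, rfl⟩; exact h q)

/-- A bound for an operator on the span of the canonical basis is a bound for its norm. -/
theorem opNorm_le_of_span_delta {P E : Type*} [NormedAddCommGroup E] [NormedSpace ℂ E]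
    {A : L2 P →L[ℂ] E} {C : ℝ} (hC : 0 ≤ C)
    (h : ∀ x ∈ Submodule.span ℂ (Set.range (delta : P → L2 P)), ‖A x‖ ≤ C * ‖x‖) : ‖A‖ ≤ C := by
  refine A.opNorm_le_bound hC fun x => ?_
  have hcl : IsClosed {x : L2 P | ‖A x‖ ≤ C * ‖x‖} :=
    isClosed_le (by fun_prop) (by fun_prop)
  exact hcl.closure_subset_iff.mpr h (dense_span_delta P x)

theorem orthonormal_weighted {P Q : Type*} (s : Q → Circle) {f : Q → P}
    (hf : Function.Injective f) :
    Orthonormal ℂ (fun q : Q => ((s q : Circle) : ℂ) • (delta (f q) : L2 P)) := by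
  have h := (orthonormal_delta P).comp f hf
  refine ⟨fun q => ?_, fun q r hqr => ?_⟩
  · change ‖((s q : Circle) : ℂ) • (delta (f q) : L2 P)‖ = 1
    rw [norm_smul, (orthonormal_delta P).1, Circle.norm_coe, one_mul]
  · have h0 : inner ℂ (delta (f q) : L2 P) (delta (f r)) = 0 := h.2 hqr
    change inner ℂ (((s q : Circle) : ℂ) • (delta (f q) : L2 P))
      (((s r : Circle) : ℂ) • (delta (f r) : L2 P)) = 0
    rw [inner_smul_left, inner_smul_right, h0, mul_zero, mul_zero]

/-- The isometry of `ℓ²(Q)` into `ℓ²(P)` with `δ_q ↦ s(q) δ_{f(q)}`. -/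
def weightedIsometry {P Q : Type*} (s : Q → Circle) {f : Q → P} (hf : Function.Injective f) :
    L2 Q →ₗᵢ[ℂ] L2 P :=
  (orthonormal_weighted s hf).orthogonalFamily.linearIsometry

theorem weightedIsometry_delta {P Q : Type*} (s : Q → Circle) {f : Q → P}
    (hf : Function.Injective f) (q : Q) :
    weightedIsometry s hf (delta q) = ((s q : Circle) : ℂ) • (delta (f q) : L2 P) := by
  classical
  have h := (orthonormal_weighted s hf).orthogonalFamily.linearIsometry_apply_single
    (i := q) (1 : ℂ)
  have h1 : (delta q : L2 Q) = lp.single 2 q (1 : ℂ) := by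
    unfold delta
    congr
  rw [h1]
  refine Eq.trans h ?_
  simp

variable {P : Type*}

theorem norm_leftRegular_apply [AddMonoid P] [IsLeftCancelAdd P] (σ : P → P → Circle) (p : P)
    (x : L2 P) : ‖leftRegular σ p x‖ = ‖x‖ :=
  LinearIsometry.norm_map _ x

theorem star_leftRegular_mul_self [AddMonoid P] [IsLeftCancelAdd P] (σ : P → P → Circle) (p : P) :
    star (leftRegular σ p) * leftRegular σ p = 1 :=
  (ContinuousLinearMap.norm_map_iff_adjoint_comp_self _).mp (norm_leftRegular_apply σ p)

theorem star_leftRegular_apply [AddMonoid P] [IsLeftCancelAdd P] (σ : P → P → Circle) (p : P)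
    (x : L2 P) : star (leftRegular σ p) (leftRegular σ p x) = x :=
  DFunLike.congr_fun (star_leftRegular_mul_self σ p) x

theorem star_leftRegular_delta [AddMonoid P] [IsLeftCancelAdd P] (σ : P → P → Circle) (p q : P) :
    star (leftRegular σ p) (delta (p + q)) = (((σ p q)⁻¹ : Circle) : ℂ) • (delta q : L2 P) := by
  have h := star_leftRegular_apply σ p (delta q)
  rw [leftRegular_delta, map_smul] at h
  rw [← h, smul_smul, ← Circle.coe_mul, inv_mul_cancel, Circle.coe_one, one_smul]

theorem leftRegular_mul [AddMonoid P] [IsLeftCancelAdd P] {σ : P → P → Circle}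
    (hσ : IsTwoCocycle σ) (p q : P) :
    leftRegular σ p * leftRegular σ q = ((σ p q : Circle) : ℂ) • leftRegular σ (p + q) := by
  refine clm_ext_delta fun r => ?_
  simp only [mul_apply_eq_comp, smul_apply, leftRegular_delta,
    map_smul, smul_smul, ← Circle.coe_mul, add_assoc, hσ p q r]
  rw [mul_comm]

theorem leftRegular_zero [AddMonoid P] [IsLeftCancelAdd P] {σ : P → P → Circle}
    (hσ : IsTwoCocycle σ) : leftRegular σ 0 = ((σ 0 0 : Circle) : ℂ) • 1 := by
  refine clm_ext_delta fun r => ?_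
  simp [leftRegular_delta, hσ.zero_left r]

/-- The adjoint is a left inverse and the right-hand side a right inverse, so they coincide; the
scalar cancels `λ_p λ_{-p} = τ(p, -p) τ(0, 0)`. -/
theorem star_leftRegular_eq [AddGroup P] {τ : P → P → Circle} (hτ : IsTwoCocycle τ) (p : P) :
    star (leftRegular τ p) =
      (((τ p (-p) * τ 0 0)⁻¹ : Circle) : ℂ) • leftRegular τ (-p) := by
  have h : leftRegular τ p * ((((τ p (-p) * τ 0 0)⁻¹ : Circle) : ℂ) • leftRegular τ (-p)) = 1 := by
    rw [mul_smul_comm, leftRegular_mul hτ, add_neg_cancel, leftRegular_zero hτ, smul_smul,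
      smul_smul, mul_assoc, ← Circle.coe_mul, ← Circle.coe_mul, inv_mul_cancel, Circle.coe_one,
      one_smul]
  exact left_inv_eq_right_inv (star_leftRegular_mul_self τ p) h

theorem leftRegular_mul_star_self [AddGroup P] {τ : P → P → Circle} (hτ : IsTwoCocycle τ) (p : P) :
    leftRegular τ p * star (leftRegular τ p) = 1 := by
  rw [star_leftRegular_eq hτ, mul_smul_comm, leftRegular_mul hτ, add_neg_cancel,
    leftRegular_zero hτ, smul_smul, smul_smul, mul_assoc, ← Circle.coe_mul, ← Circle.coe_mul,
    inv_mul_cancel, Circle.coe_one, one_smul]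

/-- The right regular isometry `δ_q ↦ τ(q, m) δ_{q + m}`. -/
def rightRegular [AddGroup P] (τ : P → P → Circle) (m : P) : L2 P →ₗᵢ[ℂ] L2 P :=
  weightedIsometry (fun q => τ q m) (add_left_injective m)

/-- On `δ_q` this is the cocycle identity at `(p, q, m)`. -/
theorem leftRegular_rightRegular [AddGroup P] {τ : P → P → Circle} (hτ : IsTwoCocycle τ)
    (p m : P) (x : L2 P) :
    leftRegular τ p (rightRegular τ m x) = rightRegular τ m (leftRegular τ p x) := by
  have : (leftRegular τ p).comp (rightRegular τ m).toContinuousLinearMap =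
      (rightRegular τ m).toContinuousLinearMap.comp (leftRegular τ p) := by
    refine clm_ext_delta fun q => ?_
    simp only [ContinuousLinearMap.comp_apply, LinearIsometry.coe_toContinuousLinearMap,
      leftRegular_delta, rightRegular, weightedIsometry_delta, map_smul, smul_smul,
      ← Circle.coe_mul, add_assoc, hτ p q m]
    rw [mul_comm]
  exact DFunLike.congr_fun this x

end Operators

/-! ### Comparing operators on `ℓ²(ℕⁿ)` and `ℓ²(ℤⁿ)` away from the boundary. -/

section Compression

variable {n : ℕ}

/-- The isometric embedding of `ℓ²(ℕⁿ)` in `ℓ²(ℤⁿ)`. -/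
def embed (n : ℕ) : L2 (Fin n → ℕ) →ₗᵢ[ℂ] L2 (Fin n → ℤ) :=
  weightedIsometry 1 natToInt_injective

theorem embed_delta (q : Fin n → ℕ) : embed n (delta q) = delta (natToInt q) := by
  simp [embed, weightedIsometry_delta]

/-- The span of the basis vectors `δ_q` with `k ≤ q`. -/
def tailSpan (k : Fin n → ℕ) : Submodule ℂ (L2 (Fin n → ℕ)) :=
  Submodule.span ℂ (delta '' Set.Ici k)

theorem delta_mem_tailSpan {k q : Fin n → ℕ} (h : k ≤ q) : delta q ∈ tailSpan k :=
  Submodule.subset_span ⟨q, h, rfl⟩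

theorem tailSpan_antitone : Antitone (tailSpan : (Fin n → ℕ) → _) := fun _ _ h =>
  Submodule.span_mono (Set.image_mono (Set.Ici_subset_Ici.mpr h))

/-- A pair of operators on `ℓ²(ℕⁿ)` and `ℓ²(ℤⁿ)` that agree far away from the boundary, with the
first one moving vectors only by a bounded amount. -/
def AgreeAtInfinity
    (x : (L2 (Fin n → ℕ) →L[ℂ] L2 (Fin n → ℕ)) × (L2 (Fin n → ℤ) →L[ℂ] L2 (Fin n → ℤ))) : Prop :=
  ∀ k', ∃ k, ∀ v ∈ tailSpan k, x.1 v ∈ tailSpan k' ∧ embed n (x.1 v) = x.2 (embed n v)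

theorem agree_on_tailSpan
    {x : (L2 (Fin n → ℕ) →L[ℂ] L2 (Fin n → ℕ)) × (L2 (Fin n → ℤ) →L[ℂ] L2 (Fin n → ℤ))}
    {k k' : Fin n → ℕ} (h : ∀ q, k ≤ q →
      x.1 (delta q) ∈ tailSpan k' ∧ embed n (x.1 (delta q)) = x.2 (delta (natToInt q)))
    {v : L2 (Fin n → ℕ)} (hv : v ∈ tailSpan k) :
    x.1 v ∈ tailSpan k' ∧ embed n (x.1 v) = x.2 (embed n v) := by
  induction hv using Submodule.span_induction with
  | mem v hv =>
    obtain ⟨q, hq, rfl⟩ := hv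
    rw [embed_delta]
    exact h q hq
  | zero => simp
  | add v w _ _ hv hw =>
    simp only [map_add]
    exact ⟨add_mem hv.1 hw.1, by rw [hv.2, hw.2]⟩
  | smul c v _ hv =>
    simp only [map_smul]
    exact ⟨Submodule.smul_mem _ _ hv.1, by rw [hv.2]⟩

theorem AgreeAtInfinity.add
    {x y : (L2 (Fin n → ℕ) →L[ℂ] L2 (Fin n → ℕ)) × (L2 (Fin n → ℤ) →L[ℂ] L2 (Fin n → ℤ))}
    (hx : AgreeAtInfinity x) (hy : AgreeAtInfinity y) : AgreeAtInfinity (x + y) := by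
  intro k'
  obtain ⟨k, hk⟩ := hx k'
  obtain ⟨l, hl⟩ := hy k'
  refine ⟨k ⊔ l, fun v hv => ?_⟩
  obtain ⟨h1, h2⟩ := hk v (tailSpan_antitone le_sup_left hv)
  obtain ⟨h3, h4⟩ := hl v (tailSpan_antitone le_sup_right hv)
  simp only [Prod.fst_add, Prod.snd_add, add_apply, map_add]
  exact ⟨add_mem h1 h3, by rw [h2, h4]⟩

/-- The bounded-displacement clause is needed here: `y.1` must keep vectors where `x.1` and `x.2`
agree. -/
theorem AgreeAtInfinity.mul
    {x y : (L2 (Fin n → ℕ) →L[ℂ] L2 (Fin n → ℕ)) × (L2 (Fin n → ℤ) →L[ℂ] L2 (Fin n → ℤ))}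
    (hx : AgreeAtInfinity x) (hy : AgreeAtInfinity y) : AgreeAtInfinity (x * y) := by
  intro k'
  obtain ⟨k, hk⟩ := hx k'
  obtain ⟨l, hl⟩ := hy k
  refine ⟨l, fun v hv => ?_⟩
  obtain ⟨h1, h2⟩ := hl v hv
  obtain ⟨h3, h4⟩ := hk _ h1
  simp only [Prod.fst_mul, Prod.snd_mul, mul_apply_eq_comp]
  exact ⟨h3, by rw [h4, h2]⟩

theorem agreeAtInfinity_algebraMap (c : ℂ) : AgreeAtInfinity (n := n) (algebraMap ℂ _ c) := by
  intro k
  refine ⟨k, fun v hv => ?_⟩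
  simp only [Algebra.algebraMap_eq_smul_one, Prod.smul_fst, Prod.smul_snd, Prod.fst_one,
    Prod.snd_one, smul_apply, one_apply_eq_self, map_smul]
  exact ⟨Submodule.smul_mem _ _ hv, trivial⟩

variable {σ : (Fin n → ℕ) → (Fin n → ℕ) → Circle} {τ : (Fin n → ℤ) → (Fin n → ℤ) → Circle}

theorem agreeAtInfinity_leftRegular (hστ : Extends τ σ) (p : Fin n → ℕ) :
    AgreeAtInfinity (leftRegular σ p, leftRegular τ (natToInt p)) := by
  intro k
  refine ⟨k, fun v hv => agree_on_tailSpan (fun q hq => ?_) hv⟩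
  simp only [leftRegular_delta, map_smul, embed_delta, natToInt_add, hστ p q, and_true]
  exact Submodule.smul_mem _ _ (delta_mem_tailSpan (le_add_left hq))

theorem agreeAtInfinity_star_leftRegular (hστ : Extends τ σ) (p : Fin n → ℕ) :
    AgreeAtInfinity (star (leftRegular σ p, leftRegular τ (natToInt p))) := by
  intro k
  -- Beyond `p` the adjoint never meets the boundary, where it would give zero; the extra `k` leaves
  -- room for the shift back by `p`.
  refine ⟨p + k, fun v hv => agree_on_tailSpan (fun q hq => ?_) hv⟩
  obtain ⟨r, rfl⟩ := exists_add_of_le ((le_add_right le_rfl).trans hq)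
  simp only [Prod.fst_star, Prod.snd_star, natToInt_add, star_leftRegular_delta, map_smul,
    embed_delta, hστ p r, and_true]
  exact Submodule.smul_mem _ _ (delta_mem_tailSpan (le_of_add_le_add_left hq))

variable (σ τ) in
/-- The `*`-algebra generated by the pairs `(L^σ_p, λ^τ_p)` for `p` in `ℕⁿ`. -/
def pairAlgebra :
    StarSubalgebra ℂ
      ((L2 (Fin n → ℕ) →L[ℂ] L2 (Fin n → ℕ)) × (L2 (Fin n → ℤ) →L[ℂ] L2 (Fin n → ℤ))) :=
  StarAlgebra.adjoin ℂ (Set.range fun p => (leftRegular σ p, leftRegular τ (natToInt p)))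

theorem pair_mem_pairAlgebra (p : Fin n → ℕ) :
    (leftRegular σ p, leftRegular τ (natToInt p)) ∈ pairAlgebra σ τ :=
  StarAlgebra.subset_adjoin ℂ _ ⟨p, rfl⟩

/-- Adjoints are taken only of generators, so `Q` need not be stable under `star`; this is not
evident for `AgreeAtInfinity`. -/
theorem pairAlgebra_induction
    {Q : (L2 (Fin n → ℕ) →L[ℂ] L2 (Fin n → ℕ)) × (L2 (Fin n → ℤ) →L[ℂ] L2 (Fin n → ℤ)) → Prop}
    (gen : ∀ p, Q (leftRegular σ p, leftRegular τ (natToInt p)))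
    (star_gen : ∀ p, Q (star (leftRegular σ p, leftRegular τ (natToInt p))))
    (scalar : ∀ c : ℂ, Q (algebraMap ℂ _ c)) (add : ∀ x y, Q x → Q y → Q (x + y))
    (mul : ∀ x y, Q x → Q y → Q (x * y))
    {x : (L2 (Fin n → ℕ) →L[ℂ] L2 (Fin n → ℕ)) × (L2 (Fin n → ℤ) →L[ℂ] L2 (Fin n → ℤ))}
    (hx : x ∈ pairAlgebra σ τ) : Q x := by
  rw [pairAlgebra, ← StarSubalgebra.mem_toSubalgebra, StarAlgebra.adjoin_toSubalgebra] at hx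
  induction hx using Algebra.adjoin_induction with
  | mem x hx =>
    rcases hx with ⟨p, rfl⟩ | ⟨p, hp⟩
    · exact gen p
    · rw [← star_star x, ← hp]
      exact star_gen p
  | algebraMap c => exact scalar c
  | add x y _ _ hx hy => exact add x y hx hy
  | mul x y _ _ hx hy => exact mul x y hx hy

theorem agreeAtInfinity_of_mem (hστ : Extends τ σ)
    {x : (L2 (Fin n → ℕ) →L[ℂ] L2 (Fin n → ℕ)) × (L2 (Fin n → ℤ) →L[ℂ] L2 (Fin n → ℤ))}
    (hx : x ∈ pairAlgebra σ τ) : AgreeAtInfinity x :=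
  pairAlgebra_induction (agreeAtInfinity_leftRegular hστ) (agreeAtInfinity_star_leftRegular hστ)
    agreeAtInfinity_algebraMap (fun _ _ => .add) (fun _ _ => .mul) hx

theorem snd_rightRegular_of_mem (hτ : IsTwoCocycle τ)
    {x : (L2 (Fin n → ℕ) →L[ℂ] L2 (Fin n → ℕ)) × (L2 (Fin n → ℤ) →L[ℂ] L2 (Fin n → ℤ))}
    (hx : x ∈ pairAlgebra σ τ) (m : Fin n → ℤ) (v : L2 (Fin n → ℤ)) :
    x.2 (rightRegular τ m v) = rightRegular τ m (x.2 v) := by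
  revert v
  refine pairAlgebra_induction (Q := fun x => ∀ v, x.2 (rightRegular τ m v) =
    rightRegular τ m (x.2 v)) (fun p v => ?_) (fun p v => ?_) (fun c v => ?_)
    (fun x y hx hy v => ?_) (fun x y hx hy v => ?_) hx
  · exact leftRegular_rightRegular hτ _ _ _
  · simp only [Prod.snd_star, star_leftRegular_eq hτ, smul_apply,
      leftRegular_rightRegular hτ, map_smul]
  · simp [Algebra.algebraMap_eq_smul_one]
  · simp [hx, hy]
  · simp [hx, hy]

/-- Finitely supported vectors on `ℤⁿ` are moved by right translations into `ℓ²(ℕⁿ)`, far away from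
the boundary. -/
theorem exists_rightRegular_mem_tailSpan (τ : (Fin n → ℤ) → (Fin n → ℤ) → Circle)
    (k : Fin n → ℕ) {v : L2 (Fin n → ℤ)}
    (hv : v ∈ Submodule.span ℂ (Set.range (delta : (Fin n → ℤ) → L2 (Fin n → ℤ)))) :
    ∃ m₀ : Fin n → ℤ, ∀ m, m₀ ≤ m →
      rightRegular τ m v ∈ (tailSpan k).map (embed n).toLinearMap := by
  induction hv using Submodule.span_induction with
  | mem v hv =>
    obtain ⟨q, rfl⟩ := hv
    refine ⟨natToInt k - q, fun m hm => ?_⟩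
    rw [rightRegular, weightedIsometry_delta]
    refine Submodule.smul_mem _ _ ?_
    have hq (i) : (k i : ℤ) ≤ (q + m) i := by
      have := hm i
      simp only [Pi.sub_apply, natToInt, Pi.add_apply] at this ⊢
      lia
    have h : natToInt (fun i => ((q + m) i).toNat) = q + m := by
      ext i
      exact Int.toNat_of_nonneg ((Int.natCast_nonneg _).trans (hq i))
    refine ⟨delta fun i => ((q + m) i).toNat, delta_mem_tailSpan fun i => ?_, ?_⟩
    · have := hq i
      lia
    · rw [← h]
      exact embed_delta _
  | zero => exact ⟨0, by simp⟩
  | add v w _ _ hv hw =>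
    obtain ⟨a, ha⟩ := hv
    obtain ⟨b, hb⟩ := hw
    refine ⟨a ⊔ b, fun m hm => ?_⟩
    rw [map_add]
    exact add_mem (ha m (le_sup_left.trans hm)) (hb m (le_sup_right.trans hm))
  | smul c v _ hv =>
    obtain ⟨a, ha⟩ := hv
    refine ⟨a, fun m hm => ?_⟩
    rw [map_smul]
    exact Submodule.smul_mem _ _ (ha m hm)

/-- Translate a finitely supported `v` isometrically on the right into the region of agreement. As
`x.2` commutes with this, `‖x.2 v‖` is the norm of `x.1` applied to a vector of norm `‖v‖`. -/
theorem norm_snd_le_norm_fst (hτ : IsTwoCocycle τ) (hστ : Extends τ σ)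
    {x : (L2 (Fin n → ℕ) →L[ℂ] L2 (Fin n → ℕ)) × (L2 (Fin n → ℤ) →L[ℂ] L2 (Fin n → ℤ))}
    (hx : x ∈ pairAlgebra σ τ) : ‖x.2‖ ≤ ‖x.1‖ := by
  refine opNorm_le_of_span_delta (norm_nonneg _) fun v hv => ?_
  -- Only the agreement is used, so the target tail is taken to be the trivial one, `0`.
  obtain ⟨k, hk⟩ := agreeAtInfinity_of_mem hστ hx 0
  obtain ⟨m, hm⟩ := exists_rightRegular_mem_tailSpan τ k hv
  obtain ⟨w, hw, hwv⟩ := hm m le_rfl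
  have hwv : embed n w = rightRegular τ m v := hwv
  rw [← (rightRegular τ m).norm_map (x.2 v), ← snd_rightRegular_of_mem hτ hx, ← hwv,
    ← (hk w hw).2, (embed n).norm_map, ← (rightRegular τ m).norm_map v, ← hwv, (embed n).norm_map]
  exact x.1.le_opNorm w

/-- The isometry `L_m` maps finitely supported vectors into the tail beyond `m`, where `x.1` acts as
`x.2`. -/
theorem exists_norm_mul_leftRegular_le (hστ : Extends τ σ)
    {x : (L2 (Fin n → ℕ) →L[ℂ] L2 (Fin n → ℕ)) × (L2 (Fin n → ℤ) →L[ℂ] L2 (Fin n → ℤ))}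
    (hx : x ∈ pairAlgebra σ τ) : ∃ m, ‖x.1 * leftRegular σ m‖ ≤ ‖x.2‖ := by
  obtain ⟨m, hm⟩ := agreeAtInfinity_of_mem hστ hx 0
  refine ⟨m, opNorm_le_of_span_delta (norm_nonneg _) fun v hv => ?_⟩
  have h : leftRegular σ m v ∈ tailSpan m := by
    induction hv using Submodule.span_induction with
    | mem v hv =>
      obtain ⟨q, rfl⟩ := hv
      rw [leftRegular_delta]
      exact Submodule.smul_mem _ _ (delta_mem_tailSpan (le_add_right le_rfl))
    | zero => simp
    | add v w _ _ hv hw => simpa using add_mem hv hw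
    | smul c v _ hv => simpa using Submodule.smul_mem _ _ hv
  rw [mul_apply_eq_comp, ← (embed n).norm_map, (hm _ h).2,
    ← norm_leftRegular_apply σ m v, ← (embed n).norm_map (leftRegular σ m v)]
  exact x.2.le_opNorm _

end Compression

/-! ### The quotient map, its surjectivity and its kernel. -/

section Quotient

theorem isClosed_reducedAlgebra {P : Type*} [AddMonoid P] [IsLeftCancelAdd P]
    (σ : P → P → Circle) : IsClosed (reducedAlgebra σ : Set (L2 P →L[ℂ] L2 P)) :=
  StarSubalgebra.isClosed_topologicalClosure _

instance {P : Type*} [AddMonoid P] [IsLeftCancelAdd P] (σ : P → P → Circle) :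
    CompleteSpace (reducedAlgebra σ) :=
  (isClosed_reducedAlgebra σ).completeSpace_coe

/-- A `*`-homomorphism between reduced algebras is contractive. -/
theorem norm_starAlgHom_le {P Q : Type*} [AddMonoid P] [IsLeftCancelAdd P] [AddMonoid Q]
    [IsLeftCancelAdd Q] {σ : P → P → Circle} {τ : Q → Q → Circle}
    (φ : reducedAlgebra σ →⋆ₐ[ℂ] reducedAlgebra τ) (T : reducedAlgebra σ) : ‖φ T‖ ≤ ‖T‖ := by
  let := StarSubalgebra.cstarAlgebra (reducedAlgebra σ) (h_closed := isClosed_reducedAlgebra σ)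
  let := StarSubalgebra.cstarAlgebra (reducedAlgebra τ) (h_closed := isClosed_reducedAlgebra τ)
  exact NonUnitalStarAlgHom.norm_apply_le φ T

theorem continuous_starAlgHom {P Q : Type*} [AddMonoid P] [IsLeftCancelAdd P] [AddMonoid Q]
    [IsLeftCancelAdd Q] {σ : P → P → Circle} {τ : Q → Q → Circle}
    (φ : reducedAlgebra σ →⋆ₐ[ℂ] reducedAlgebra τ) : Continuous φ :=
  AddMonoidHomClass.continuous_of_bound φ 1 fun T => by simpa using norm_starAlgHom_le φ T

theorem starAlgHom_ext_gen {P Q : Type*} [AddMonoid P] [IsLeftCancelAdd P] [AddMonoid Q]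
    [IsLeftCancelAdd Q] {σ : P → P → Circle} {τ : Q → Q → Circle}
    {φ ψ : reducedAlgebra σ →⋆ₐ[ℂ] reducedAlgebra τ} (h : ∀ p, φ (gen σ p) = ψ (gen σ p)) :
    φ = ψ := by
  refine StarAlgHom.ext_topologicalClosure (S := StarAlgebra.adjoin ℂ (Set.range (leftRegular σ)))
    (continuous_starAlgHom φ) (continuous_starAlgHom ψ) (StarAlgHom.ext_adjoin ?_)
  rintro ⟨_, hx⟩ ⟨p, rfl⟩
  exact h p

variable {n : ℕ} {σ : (Fin n → ℕ) → (Fin n → ℕ) → Circle} {τ : (Fin n → ℤ) → (Fin n → ℤ) → Circle}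

variable (σ τ) in
/-- The `C*`-algebra generated by the pairs `(L^σ_p, λ^τ_p)` for `p` in `ℕⁿ`. -/
def pairClosure :
    StarSubalgebra ℂ
      ((L2 (Fin n → ℕ) →L[ℂ] L2 (Fin n → ℕ)) × (L2 (Fin n → ℤ) →L[ℂ] L2 (Fin n → ℤ))) :=
  (pairAlgebra σ τ).topologicalClosure

theorem isClosed_pairClosure : IsClosed (pairClosure σ τ : Set
    ((L2 (Fin n → ℕ) →L[ℂ] L2 (Fin n → ℕ)) × (L2 (Fin n → ℤ) →L[ℂ] L2 (Fin n → ℤ)))) :=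
  StarSubalgebra.isClosed_topologicalClosure _

theorem pair_mem_pairClosure (p : Fin n → ℕ) :
    (leftRegular σ p, leftRegular τ (natToInt p)) ∈ pairClosure σ τ :=
  StarSubalgebra.le_topologicalClosure _ (pair_mem_pairAlgebra p)

theorem pairClosure_induction
    {C : Set ((L2 (Fin n → ℕ) →L[ℂ] L2 (Fin n → ℕ)) × (L2 (Fin n → ℤ) →L[ℂ] L2 (Fin n → ℤ)))}
    (hC : IsClosed C) (h : ∀ x ∈ pairAlgebra σ τ, x ∈ C)
    {x : (L2 (Fin n → ℕ) →L[ℂ] L2 (Fin n → ℕ)) × (L2 (Fin n → ℤ) →L[ℂ] L2 (Fin n → ℤ))}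
    (hx : x ∈ pairClosure σ τ) : x ∈ C :=
  closure_minimal h hC hx

theorem leftRegular_mem_reducedAlgebra {P : Type*} [AddMonoid P] [IsLeftCancelAdd P]
    (σ : P → P → Circle) (p : P) : leftRegular σ p ∈ reducedAlgebra σ :=
  (gen σ p).2

theorem fst_mem_reducedAlgebra
    {x : (L2 (Fin n → ℕ) →L[ℂ] L2 (Fin n → ℕ)) × (L2 (Fin n → ℤ) →L[ℂ] L2 (Fin n → ℤ))}
    (hx : x ∈ pairClosure σ τ) : x.1 ∈ reducedAlgebra σ := by
  refine pairClosure_induction (C := Prod.fst ⁻¹' (reducedAlgebra σ : Set _))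
    ((isClosed_reducedAlgebra σ).preimage continuous_fst) (fun x hx => ?_) hx
  exact pairAlgebra_induction (Q := fun x => x.1 ∈ reducedAlgebra σ)
    (leftRegular_mem_reducedAlgebra σ) (fun p => star_mem (leftRegular_mem_reducedAlgebra σ p))
    (fun c => algebraMap_mem _ c) (fun _ _ => add_mem) (fun _ _ => mul_mem) hx

theorem snd_mem_reducedAlgebra
    {x : (L2 (Fin n → ℕ) →L[ℂ] L2 (Fin n → ℕ)) × (L2 (Fin n → ℤ) →L[ℂ] L2 (Fin n → ℤ))}
    (hx : x ∈ pairClosure σ τ) : x.2 ∈ reducedAlgebra τ := by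
  refine pairClosure_induction (C := Prod.snd ⁻¹' (reducedAlgebra τ : Set _))
    ((isClosed_reducedAlgebra τ).preimage continuous_snd) (fun x hx => ?_) hx
  exact pairAlgebra_induction (Q := fun x => x.2 ∈ reducedAlgebra τ)
    (fun p => leftRegular_mem_reducedAlgebra τ _)
    (fun p => star_mem (leftRegular_mem_reducedAlgebra τ _))
    (fun c => algebraMap_mem _ c) (fun _ _ => add_mem) (fun _ _ => mul_mem) hx

theorem norm_snd_le_norm_fst_of_mem_pairClosure (hτ : IsTwoCocycle τ) (hστ : Extends τ σ)
    {x : (L2 (Fin n → ℕ) →L[ℂ] L2 (Fin n → ℕ)) × (L2 (Fin n → ℤ) →L[ℂ] L2 (Fin n → ℤ))}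
    (hx : x ∈ pairClosure σ τ) : ‖x.2‖ ≤ ‖x.1‖ :=
  pairClosure_induction (C := {x | ‖x.2‖ ≤ ‖x.1‖})
    (isClosed_le continuous_snd.norm continuous_fst.norm)
    (fun _ hx => norm_snd_le_norm_fst hτ hστ hx) hx

variable (σ τ) in
/-- The first projection of the algebra of pairs. -/
def pairFst : pairClosure σ τ →⋆ₐ[ℂ] reducedAlgebra σ :=
  ((StarAlgHom.fst ℂ _ _).comp (pairClosure σ τ).subtype).codRestrict _
    fun x => fst_mem_reducedAlgebra x.2

variable (σ τ) in
/-- The second projection of the algebra of pairs. -/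
def pairSnd : pairClosure σ τ →⋆ₐ[ℂ] reducedAlgebra τ :=
  ((StarAlgHom.snd ℂ _ _).comp (pairClosure σ τ).subtype).codRestrict _
    fun x => snd_mem_reducedAlgebra x.2

/-- The product carries the max norm, and the first component dominates. -/
theorem isometry_pairFst (hτ : IsTwoCocycle τ) (hστ : Extends τ σ) : Isometry (pairFst σ τ) := by
  refine AddMonoidHomClass.isometry_of_norm _ fun x => ?_
  exact (max_eq_left (norm_snd_le_norm_fst_of_mem_pairClosure hτ hστ x.2)).symm

/-- An isometric image of a complete algebra is closed, and this one contains the generators. -/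
theorem bijective_pairFst (hτ : IsTwoCocycle τ) (hστ : Extends τ σ) :
    Function.Bijective (pairFst σ τ) := by
  have hi := isometry_pairFst hτ hστ
  refine ⟨hi.injective, fun T => ?_⟩
  have : CompleteSpace (pairClosure σ τ) := isClosed_pairClosure.completeSpace_coe
  let f : pairClosure σ τ →⋆ₐ[ℂ] (L2 (Fin n → ℕ) →L[ℂ] L2 (Fin n → ℕ)) :=
    (reducedAlgebra σ).subtype.comp (pairFst σ τ)
  have hf : Isometry f := isometry_subtype_coe.comp hi
  have hle : reducedAlgebra σ ≤ f.range := by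
    refine StarSubalgebra.topologicalClosure_minimal (StarAlgebra.adjoin_le ?_)
      hf.isClosedEmbedding.isClosed_range
    rintro _ ⟨p, rfl⟩
    exact ⟨⟨_, pair_mem_pairClosure p⟩, rfl⟩
  obtain ⟨x, hx⟩ := hle T.2
  exact ⟨x, Subtype.ext hx⟩

/-- The `*`-homomorphism `𝒯_r(ℕⁿ, σ) → C*_r(ℤⁿ, τ)` with `L^σ_p ↦ λ^τ_p`. -/
def toeplitzQuotient (hτ : IsTwoCocycle τ) (hστ : Extends τ σ) :
    reducedAlgebra σ →⋆ₐ[ℂ] reducedAlgebra τ :=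
  (pairSnd σ τ).comp
    (StarAlgEquiv.ofBijective (pairFst σ τ) (bijective_pairFst hτ hστ)).symm.toStarAlgHom

theorem toeplitzQuotient_pairFst (hτ : IsTwoCocycle τ) (hστ : Extends τ σ)
    (x : pairClosure σ τ) : toeplitzQuotient hτ hστ (pairFst σ τ x) = pairSnd σ τ x :=
  congrArg (pairSnd σ τ) ((StarAlgEquiv.ofBijective (pairFst σ τ)
    (bijective_pairFst hτ hστ)).symm_apply_apply x)

theorem toeplitzQuotient_gen (hτ : IsTwoCocycle τ) (hστ : Extends τ σ) (p : Fin n → ℕ) :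
    toeplitzQuotient hτ hστ (gen σ p) = gen τ (natToInt p) :=
  toeplitzQuotient_pairFst hτ hστ ⟨_, pair_mem_pairClosure p⟩

/-- Cutting down by a projection `L_m L_m^*` controls the norm of the first component of a pair by
that of the second one, which does not change. -/
theorem exists_norm_mul_projection_le (hτ : IsTwoCocycle τ) (hστ : Extends τ σ)
    {x : (L2 (Fin n → ℕ) →L[ℂ] L2 (Fin n → ℕ)) × (L2 (Fin n → ℤ) →L[ℂ] L2 (Fin n → ℤ))}
    (hx : x ∈ pairAlgebra σ τ) :
    ∃ m, ‖x.1 * (leftRegular σ m * star (leftRegular σ m))‖ ≤ ‖x.2‖ ∧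
      (x.1 * (leftRegular σ m * star (leftRegular σ m)), x.2) ∈ pairAlgebra σ τ := by
  obtain ⟨m, hm⟩ := exists_norm_mul_leftRegular_le hστ hx
  refine ⟨m, ?_, ?_⟩
  · have h1 : ‖star (leftRegular σ m)‖ ≤ 1 := by
      refine (LinearIsometryEquiv.norm_map ContinuousLinearMap.adjoint _).trans_le ?_
      exact ContinuousLinearMap.opNorm_le_bound _ zero_le_one fun v => by
        rw [norm_leftRegular_apply, one_mul]
    rw [← mul_assoc]
    refine (norm_mul_le _ _).trans ((mul_le_mul hm h1 (norm_nonneg _) (norm_nonneg _)).trans ?_)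
    rw [mul_one]
  · have hg := pair_mem_pairAlgebra (σ := σ) (τ := τ) m
    have h := mul_mem hx (mul_mem hg (star_mem hg))
    convert h using 1
    refine Prod.ext rfl ?_
    simp only [Prod.snd_mul, Prod.snd_star, leftRegular_mul_star_self hτ, mul_one]

/-- Every generator of the group algebra is a multiple of `λ_b^* λ_a` with `a, b` in `ℕⁿ`. -/
theorem exists_leftRegular_eq (hτ : IsTwoCocycle τ) (p : Fin n → ℤ) :
    ∃ (c : ℂ) (a b : Fin n → ℕ), leftRegular τ p =
      c • (star (leftRegular τ (natToInt b)) * leftRegular τ (natToInt a)) := by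
  -- With `a` and `b` the positive and negative parts of `p`, one has `b + p = a` and `λ_b λ_p =
  -- τ(b, p) λ_a`.
  refine ⟨τ (natToInt fun i => (-p i).toNat) p, fun i => (p i).toNat, fun i => (-p i).toNat, ?_⟩
  have hab : natToInt (fun i => (p i).toNat) = natToInt (fun i => (-p i).toNat) + p := by
    ext i
    simp only [natToInt, Pi.add_apply]
    lia
  rw [hab, ← mul_smul_comm, ← leftRegular_mul hτ, ← mul_assoc, star_leftRegular_mul_self, one_mul]

variable (σ) in
theorem adjoin_leftRegular_le_map_snd (hτ : IsTwoCocycle τ) :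
    StarAlgebra.adjoin ℂ (Set.range (leftRegular τ)) ≤
      (pairAlgebra σ τ).map (StarAlgHom.snd ℂ _ _) := by
  refine StarAlgebra.adjoin_le ?_
  rintro _ ⟨p, rfl⟩
  obtain ⟨c, a, b, h⟩ := exists_leftRegular_eq hτ p
  rw [h]
  have hmem : c • (star (leftRegular σ b, leftRegular τ (natToInt b)) *
      (leftRegular σ a, leftRegular τ (natToInt a))) ∈ pairAlgebra σ τ :=
    SMulMemClass.smul_mem c
      (mul_mem (star_mem (pair_mem_pairAlgebra b)) (pair_mem_pairAlgebra a))
  exact ⟨_, hmem, rfl⟩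

/-- On the dense subalgebra `K` the cut-down supplies lifts of no larger norm; such norm-controlled
lifting passes to the closure by completeness. -/
theorem surjective_toeplitzQuotient (hτ : IsTwoCocycle τ) (hστ : Extends τ σ) :
    Function.Surjective (toeplitzQuotient hτ hστ) := by
  let A := (pairAlgebra σ τ).map (StarAlgHom.snd ℂ _ _)
  let K : AddSubgroup (L2 (Fin n → ℤ) →L[ℂ] L2 (Fin n → ℤ)) := A.toSubring.toAddSubgroup
  let f : NormedAddGroupHom (reducedAlgebra σ) (L2 (Fin n → ℤ) →L[ℂ] L2 (Fin n → ℤ)) :=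
    AddMonoidHom.mkNormedAddGroupHom
      (((reducedAlgebra τ).subtype.comp (toeplitzQuotient hτ hστ) :
        reducedAlgebra σ →⋆ₐ[ℂ] (L2 (Fin n → ℤ) →L[ℂ] L2 (Fin n → ℤ))) : _ →+ _) 1
      fun T => by simpa using norm_starAlgHom_le (toeplitzQuotient hτ hστ) T
  have hf : f.SurjectiveOnWith K 1 := by
    rintro _ ⟨x, hx, rfl⟩
    obtain ⟨m, hm, hmem⟩ := exists_norm_mul_projection_le hτ hστ hx
    let y : pairClosure σ τ := ⟨_, StarSubalgebra.le_topologicalClosure _ hmem⟩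
    refine ⟨pairFst σ τ y, ?_, ?_⟩
    · exact congrArg Subtype.val (toeplitzQuotient_pairFst hτ hστ y)
    · rw [one_mul]
      exact hm
  intro S
  have hS : (S : L2 (Fin n → ℤ) →L[ℂ] L2 (Fin n → ℤ)) ∈ K.topologicalClosure :=
    closure_mono (adjoin_leftRegular_le_map_snd σ hτ) S.2
  obtain ⟨T, hT, -⟩ := controlled_closure_of_complete one_pos one_pos hf _ hS
  exact ⟨T, Subtype.ext hT⟩

theorem isClosed_closedIdeal {A : Type*} [Ring A] [TopologicalSpace A] (S : Set A) :
    IsClosed (closedIdeal S : Set A) := by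
  have : (closedIdeal S : Set A) =
      ⋂ I ∈ {I : TwoSidedIdeal A | IsClosed (I : Set A) ∧ S ⊆ (I : Set A)}, (I : Set A) := by
    ext x
    simp only [closedIdeal, SetLike.mem_coe, TwoSidedIdeal.mem_sInf, Set.mem_iInter]
  rw [this]
  exact isClosed_biInter fun I hI => hI.1

theorem subset_closedIdeal {A : Type*} [Ring A] [TopologicalSpace A] (S : Set A) :
    S ⊆ (closedIdeal S : Set A) := fun _ hx =>
  (TwoSidedIdeal.mem_sInf _).mpr fun _ hI => hI.2 hx

theorem closedIdeal_le {A : Type*} [Ring A] [TopologicalSpace A] {S : Set A}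
    {I : TwoSidedIdeal A} (hI : IsClosed (I : Set A)) (hS : S ⊆ (I : Set A)) : closedIdeal S ≤ I :=
  sInf_le ⟨hI, hS⟩

theorem gen_mul_star_gen_add (hσ : IsTwoCocycle σ) (p q : Fin n → ℕ) :
    gen σ (p + q) * star (gen σ (p + q)) =
      gen σ p * (gen σ q * star (gen σ q)) * star (gen σ p) := by
  have h : gen σ p * gen σ q = ((σ p q : Circle) : ℂ) • gen σ (p + q) :=
    Subtype.ext (leftRegular_mul hσ p q)
  have h' : gen σ p * (gen σ q * star (gen σ q)) * star (gen σ p) =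
      gen σ p * gen σ q * star (gen σ p * gen σ q) := by
    simp only [star_mul, mul_assoc]
  rw [h', h, star_smul, smul_mul_smul_comm, RCLike.star_def, RCLike.mul_conj, Circle.norm_coe]
  simp

/-- All range projections `L_m L_m^*` are the unit modulo the ideal. -/
theorem one_sub_mem_toeplitzIdeal (hσ : IsTwoCocycle σ) (m : Fin n → ℕ) :
    1 - gen σ m * star (gen σ m) ∈ toeplitzIdeal σ := by
  -- The set of good `m` is a submonoid, because `1 - L_{p+q} L_{p+q}^* = (1 - L_p L_p^*) + L_p (1 -
  -- L_q L_q^*) L_p^*`, and it contains the generators.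
  let M : AddSubmonoid (Fin n → ℕ) :=
    { carrier := {m | 1 - gen σ m * star (gen σ m) ∈ toeplitzIdeal σ}
      zero_mem' := by
        have h : gen σ (0 : Fin n → ℕ) = ((σ 0 0 : Circle) : ℂ) • 1 :=
          Subtype.ext (leftRegular_zero hσ)
        change 1 - gen σ 0 * star (gen σ 0) ∈ toeplitzIdeal σ
        rw [h, star_smul, smul_mul_smul_comm, RCLike.star_def, RCLike.mul_conj, Circle.norm_coe]
        simp
      add_mem' := by
        intro p q hp hq
        change 1 - gen σ (p + q) * star (gen σ (p + q)) ∈ toeplitzIdeal σ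
        have h : 1 - gen σ (p + q) * star (gen σ (p + q)) = (1 - gen σ p * star (gen σ p)) +
            gen σ p * (1 - gen σ q * star (gen σ q)) * star (gen σ p) := by
          rw [gen_mul_star_gen_add hσ, mul_sub, sub_mul, mul_one]
          abel
        rw [h]
        exact TwoSidedIdeal.add_mem _ hp
          (TwoSidedIdeal.mul_mem_right _ _ _ (TwoSidedIdeal.mul_mem_left _ _ _ hq)) }
  change m ∈ M
  rw [pi_eq_sum_univ' m]
  refine sum_mem fun i _ => nsmul_mem (?_ : _ ∈ M) _
  convert! subset_closedIdeal _ (Set.mem_range_self i)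

theorem ker_toeplitzQuotient (hσ : IsTwoCocycle σ) (hτ : IsTwoCocycle τ) (hστ : Extends τ σ) :
    TwoSidedIdeal.ker (toeplitzQuotient hτ hστ) = toeplitzIdeal σ := by
  refine le_antisymm (fun T hT => ?_) (closedIdeal_le ?_ ?_)
  · rw [TwoSidedIdeal.mem_ker] at hT
    obtain ⟨x, rfl⟩ := (bijective_pairFst hτ hστ).surjective T
    rw [toeplitzQuotient_pairFst] at hT
    have hx : x.1.2 = 0 := congrArg Subtype.val hT
    have hcl : IsClosed (toeplitzIdeal σ : Set (reducedAlgebra σ)) := isClosed_closedIdeal _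
    refine hcl.closure_subset (Metric.mem_closure_iff.mpr fun ε hε => ?_)
    obtain ⟨y, hy, hxy⟩ := Metric.mem_closure_iff.mp x.2 (ε / 2) (half_pos hε)
    obtain ⟨m, hm, -⟩ := exists_norm_mul_projection_le hτ hστ hy
    let z : pairClosure σ τ := ⟨y, StarSubalgebra.le_topologicalClosure _ hy⟩
    -- With `y` near `x` and `x.2 = 0`, `y.2` is small. The element `y.1 (1 - L_m L_m^*)` of the
    -- ideal differs from `y.1` by at most `‖y.2‖`.
    refine ⟨pairFst σ τ z * (1 - gen σ m * star (gen σ m)),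
      TwoSidedIdeal.mul_mem_left _ _ _ (one_sub_mem_toeplitzIdeal hσ m), ?_⟩
    rw [dist_eq_norm, mul_sub, mul_one, ← sub_add]
    rw [dist_eq_norm] at hxy
    have h1 : ‖x.1.1 - y.1‖ < ε / 2 := (norm_fst_le (x.1 - y)).trans_lt hxy
    have h2 : ‖y.2‖ < ε / 2 := by
      have := (norm_snd_le (x.1 - y)).trans_lt hxy
      rwa [Prod.snd_sub, hx, zero_sub, norm_neg] at this
    have h3 : ‖pairFst σ τ x - pairFst σ τ z‖ < ε / 2 := h1
    have h4 : ‖pairFst σ τ z * (gen σ m * star (gen σ m))‖ < ε / 2 := hm.trans_lt h2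
    exact (norm_add_le _ _).trans_lt ((add_lt_add h3 h4).trans_eq (add_halves ε))
  · have : (TwoSidedIdeal.ker (toeplitzQuotient hτ hστ) : Set (reducedAlgebra σ)) =
        toeplitzQuotient hτ hστ ⁻¹' {0} := by
      ext T
      exact TwoSidedIdeal.mem_ker _
    rw [this]
    exact isClosed_singleton.preimage (continuous_starAlgHom _)
  · rintro _ ⟨j, rfl⟩
    refine (TwoSidedIdeal.mem_ker _).mpr ?_
    have h (p : Fin n → ℤ) : gen τ p * star (gen τ p) = 1 :=
      Subtype.ext (leftRegular_mul_star_self hτ p)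
    simp only [map_sub, map_one, map_mul, map_star, toeplitzQuotient_gen, h, sub_self]

end Quotient

end TwistedSemigroup

end

theorem mainTheorem6 (n : ℕ) (σ : (Fin n → ℕ) → (Fin n → ℕ) → Circle)
    (hσ : TwistedSemigroup.IsTwoCocycle σ) :
    (∃ τ : (Fin n → ℤ) → (Fin n → ℤ) → Circle,
      TwistedSemigroup.IsTwoCocycle τ ∧ TwistedSemigroup.Extends τ σ) ∧
    (∀ τ₁ τ₂ : (Fin n → ℤ) → (Fin n → ℤ) → Circle,
      TwistedSemigroup.IsTwoCocycle τ₁ → TwistedSemigroup.Extends τ₁ σ →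
      TwistedSemigroup.IsTwoCocycle τ₂ → TwistedSemigroup.Extends τ₂ σ →
      TwistedSemigroup.IsCoboundary (τ₁ / τ₂)) ∧
    (∀ τ : (Fin n → ℤ) → (Fin n → ℤ) → Circle,
      TwistedSemigroup.IsTwoCocycle τ → TwistedSemigroup.Extends τ σ →
      ∃ φ : TwistedSemigroup.reducedAlgebra σ →⋆ₐ[ℂ] TwistedSemigroup.reducedAlgebra τ,
        (∀ p : Fin n → ℕ, φ (TwistedSemigroup.gen σ p) =
          TwistedSemigroup.gen τ (TwistedSemigroup.natToInt p)) ∧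
        (∀ ψ : TwistedSemigroup.reducedAlgebra σ →⋆ₐ[ℂ] TwistedSemigroup.reducedAlgebra τ,
          (∀ p : Fin n → ℕ, ψ (TwistedSemigroup.gen σ p) =
            TwistedSemigroup.gen τ (TwistedSemigroup.natToInt p)) → ψ = φ) ∧
        Function.Surjective φ ∧
        TwoSidedIdeal.ker φ = TwistedSemigroup.toeplitzIdeal σ) := by
  refine ⟨hσ.exists_extension, fun τ₁ τ₂ h₁ e₁ h₂ e₂ =>
    TwistedSemigroup.isCoboundary_div_of_extends h₁ e₁ h₂ e₂, fun τ hτ hστ => ?_⟩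
  refine ⟨TwistedSemigroup.toeplitzQuotient hτ hστ, TwistedSemigroup.toeplitzQuotient_gen hτ hστ,
    fun ψ hψ => TwistedSemigroup.starAlgHom_ext_gen fun p => ?_,
    TwistedSemigroup.surjective_toeplitzQuotient hτ hστ,
    TwistedSemigroup.ker_toeplitzQuotient hσ hτ hστ⟩
  rw [hψ, TwistedSemigroup.toeplitzQuotient_gen]
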